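/- Let $\mathcal H$ be a complex Hilbert space, $H$ a positive self-adjoint (possibly unbounded) operator on $\mathcal H$, and $E_0=\inf\langle\varphi|H|\varphi\rangle$, where the infimum is over unit vectors $\varphi$ in the domain of $H$. A state is a positive trace-class operator $\rho$ with $\mathrm{Tr}\,\rho=1$; its energy is $\mathrm{Tr}\,H\rho=\sup_n\mathrm{Tr}\,P_nH\rho\in[0,+\infty]$, where $P_n$ is the spectral projector of $H$ corresponding to $[0,n]$. For $E\ge E_0$ let $\mathfrak C_{H,E}$ be the set of states with $\mathrm{Tr}\,H\rho\le E$, and let $\mathfrak C_{H,\infty}=\bigcup_{E\ge E_0}\mathfrak C_{H,E}$. Let $f:\mathfrak C_{H,\infty}\to\mathbb R$ be locally almost affine: there are nonnegative functions $a,b$ on $(0,1)$ with $a(p),b(p)\to0$ as $p\to+0$ such that $$-a(p)\le f(p\rho+(1-p)\sigma)-pf(\rho)-(1-p)f(\sigma)\le b(p)\qquad\text{for all }p\in(0,1),\ \rho,\sigma\in\mathfrak C_{H,\infty}.$$ Suppose that $B_f(E)=\sup_{\rho\in\mathfrak C_{H,E}}|f(\rho)|<+\infty$ for all finite $E\ge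 E_0$, and put $B_f^{\pm}(E)=\sup_{\rho\in\mathfrak C_{H,E}}\max\{\pm f(\rho),0\}$. (1) Let $E\ge E_0$, $\rho,\sigma\in\mathfrak C_{H,E}$ and $\varepsilon>0$ with $\tfrac12\|\rho-\sigma\|_1\le\varepsilon\le\tfrac12$. Then $$|f(\rho)-f(\sigma)|\le 2\sqrt{2\varepsilon}\,B_f(E/\varepsilon)+(1+\sqrt{2\varepsilon})\,(a(\epsilon)+b(\epsilon)),\qquad \epsilon=\frac{\sqrt{2\varepsilon}}{1+\sqrt{2\varepsilon}},$$ and the term $2B_f(E/\varepsilon)$ can be replaced by $B_f^+(E/\varepsilon)+B_f^-(E/\varepsilon)$. (2) If $\rho,\sigma\in\mathfrak C_{H,E}$ ($E\ge E_0$) are pure states and $\tfrac12\|\rho-\sigma\|_1\le\varepsilon\le1$, $\varepsilon>0$, then both bounds hold with $\varepsilon$ replaced by $\varepsilon^2/2$ in their right-hand sides; that is, $$|f(\rho)-f(\sigma)|\le 2\varepsilon\,B_f(2E/\varepsilon^2)+(1+\varepsilon)\left(a\!\left(\tfrac{\varepsilon}{1+\varepsilon}\right)+b\!\left(\tfrac{\varepsilon}{1+\varepsilon}\right)\right),$$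 and $2B_f(2E/\varepsilon^2)$ can be replaced by $B_f^+(2E/\varepsilon^2)+B_f^-(2E/\varepsilon^2)$. (3) If $B_f(E)=o(\sqrt E)$ as $E\to+\infty$, then $f$ is uniformly continuous, with respect to the trace norm, on $\mathfrak C_{H,E}$ for every finite $E\ge E_0$. -/

import Mathlib

open scoped InnerProductSpace
open Filter Topology Asymptotics

noncomputable section

namespace QState

variable {𝓗 : Type*} [NormedAddCommGroup 𝓗] [InnerProductSpace ℂ 𝓗] [CompleteSpace 𝓗]

/-! ### Trace, trace norm, states -/

variable (𝓗) in
/-- The index set of an orthonormal basis of `𝓗`, fixed once and for all. -/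
def basisSet : Set 𝓗 := (exists_hilbertBasis ℂ 𝓗).choose

variable (𝓗) in
/-- An orthonormal basis of `𝓗`, fixed once and for all. -/
def onb : HilbertBasis (basisSet 𝓗) ℂ 𝓗 := (exists_hilbertBasis ℂ 𝓗).choose_spec.choose

/-- The trace `∑ i, ⟨e i, A e i⟩ ∈ [0, ∞]` of a positive bounded operator `A`
(its value does not depend on the orthonormal basis). -/
def posTrace (A : 𝓗 →L[ℂ] 𝓗) : ENNReal :=
  ∑' i : basisSet 𝓗, ENNReal.ofReal (⟪onb 𝓗 i, A (onb 𝓗 i)⟫_ℂ).re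

/-- The trace norm `‖T‖₁ = Tr |T| ∈ [0, ∞]` of a bounded operator, with `|T| = (T* T)^(1/2)`. -/
def traceNorm (T : 𝓗 →L[ℂ] 𝓗) : ENNReal := posTrace (CFC.abs T)

/-- Quantum states: positive operators with unit trace. -/
def IsState (ρ : 𝓗 →L[ℂ] 𝓗) : Prop := ρ.IsPositive ∧ posTrace ρ = 1

/-- `ρ = |φ⟩⟨φ|` for some unit vector `φ`. -/
def IsPure (ρ : 𝓗 →L[ℂ] 𝓗) : Prop := ∃ φ : 𝓗, ‖φ‖ = 1 ∧ ρ = InnerProductSpace.rankOne ℂ φ φ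

/-- `Tr A ρ = Tr ρ^(1/2) A ρ^(1/2) ∈ [0, ∞]` for positive bounded operators `A` and `ρ`. -/
def traceMul (A ρ : 𝓗 →L[ℂ] 𝓗) : ENNReal := posTrace (CFC.sqrt ρ * A * CFC.sqrt ρ)

/-! ### Spectral measures and the energy of a state -/

variable (𝓗) in
/-- A projection-valued measure on the Borel sets of `ℝ`: each `proj B` is an orthogonal
projection, `proj ℝ = 1`, and for every vector `x` the function `B ↦ ⟨x, proj B x⟩` is a
(countably additive) measure, called `measure x`. -/
structure ProjValuedMeasure where
  proj : Set ℝ → 𝓗 →L[ℂ] 𝓗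
  measure : 𝓗 → MeasureTheory.Measure ℝ
  isStarProjection : ∀ B, MeasurableSet B → IsStarProjection (proj B)
  proj_univ : proj Set.univ = 1
  measure_apply : ∀ x B, MeasurableSet B →
    measure x B = ENNReal.ofReal (⟪x, proj B x⟫_ℂ).re

/-- `S` is the spectral measure of the (unbounded) operator `H`, that is `H = ∫ t dS(t)`: the
domain of `H` consists of the vectors `x` with `∫ t² d⟨x, S(t) x⟩ < ∞`, and
`⟨x, H x⟩ = ∫ t d⟨x, S(t) x⟩` on the domain. -/
structure ProjValuedMeasure.IsSpectralMeasureOf (S : ProjValuedMeasure 𝓗) (H : 𝓗 →ₗ.[ℂ] 𝓗) :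
    Prop where
  mem_domain_iff : ∀ x, x ∈ H.domain ↔ ∫⁻ t, ENNReal.ofReal (t ^ 2) ∂(S.measure x) < ⊤
  inner_apply : ∀ x : H.domain, ⟪(x : 𝓗), H x⟫_ℂ = ((∫ t, t ∂(S.measure (x : 𝓗)) : ℝ) : ℂ)

/-- `P` is the spectral projector of `H` corresponding to the Borel set `B`. -/
def IsSpectralProjector (H : 𝓗 →ₗ.[ℂ] 𝓗) (B : Set ℝ) (P : 𝓗 →L[ℂ] 𝓗) : Prop :=
  ∃ S : ProjValuedMeasure 𝓗, S.IsSpectralMeasureOf H ∧ S.proj B = P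

/-- `A` is the bounded operator `P H = P H P`, where `P` is the spectral projector of `H`
corresponding to the interval `[0, n]`. -/
def IsTruncation (H : 𝓗 →ₗ.[ℂ] 𝓗) (n : ℕ) (A : 𝓗 →L[ℂ] 𝓗) : Prop :=
  ∃ P : 𝓗 →L[ℂ] 𝓗, IsSpectralProjector H (Set.Icc 0 (n : ℝ)) P ∧
    ∀ x : 𝓗, ∃ hx : P x ∈ H.domain, A x = P (H ⟨P x, hx⟩)

/-- The energy `Tr H ρ = sup_n Tr (P_n H ρ) ∈ [0, ∞]`, where `P_n` is the spectral projector of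
the positive self-adjoint operator `H` corresponding to `[0, n]`. For each `n` the
operator `A = P_n H` exists and is unique by the spectral theorem. -/
def energy (H : 𝓗 →ₗ.[ℂ] 𝓗) (ρ : 𝓗 →L[ℂ] 𝓗) : ENNReal :=
  ⨆ (n : ℕ) (A : 𝓗 →L[ℂ] 𝓗) (_ : IsTruncation H n A), traceMul A ρ

/-- A positive operator `H`, not necessarily bounded: self-adjoint (in particular
densely defined) with `⟨x, H x⟩ ≥ 0` on its domain. -/
def IsHamiltonian (H : 𝓗 →ₗ.[ℂ] 𝓗) : Prop :=
  IsSelfAdjoint H ∧ ∀ x : H.domain, 0 ≤ (⟪(x : 𝓗), H x⟫_ℂ).re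

/-- The number `E₀ = inf ⟨φ, H φ⟩` over the unit vectors `φ` in the domain of `H`. -/
def groundEnergy (H : 𝓗 →ₗ.[ℂ] 𝓗) : ℝ :=
  sInf {r : ℝ | ∃ φ : H.domain, ‖(φ : 𝓗)‖ = 1 ∧ r = (⟪(φ : 𝓗), H φ⟫_ℂ).re}

/-- The set of states with `Tr H ρ ≤ E` (used for `E ≥ E₀ ≥ 0`). -/
def energySet (H : 𝓗 →ₗ.[ℂ] 𝓗) (E : ℝ) : Set (𝓗 →L[ℂ] 𝓗) :=
  {ρ | IsState ρ ∧ energy H ρ ≤ ENNReal.ofReal E}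

/-- The set of states of finite energy. -/
def finiteEnergySet (H : 𝓗 →ₗ.[ℂ] 𝓗) : Set (𝓗 →L[ℂ] 𝓗) :=
  {ρ | ∃ E : ℝ, groundEnergy H ≤ E ∧ ρ ∈ energySet H E}

/-! ### Locally almost affine functions

A function on the set of states of finite energy is represented by a function `f` on all bounded
operators, of which only the values on that set are ever used. Similarly only the
values of `a` and `b` on `(0, 1)` are used. -/

/-- `f` is locally almost affine on the states of finite energy, with moduli `a` and `b`. -/
structure IsLAA (H : 𝓗 →ₗ.[ℂ] 𝓗) (f : (𝓗 →L[ℂ] 𝓗) → ℝ) (a b : ℝ → ℝ) : Prop where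
  a_nonneg : ∀ p ∈ Set.Ioo (0 : ℝ) 1, 0 ≤ a p
  b_nonneg : ∀ p ∈ Set.Ioo (0 : ℝ) 1, 0 ≤ b p
  a_tendsto : Tendsto a (𝓝[>] 0) (𝓝 0)
  b_tendsto : Tendsto b (𝓝[>] 0) (𝓝 0)
  lower : ∀ p ∈ Set.Ioo (0 : ℝ) 1, ∀ ρ ∈ finiteEnergySet H, ∀ σ ∈ finiteEnergySet H,
    -a p ≤ f ((p : ℂ) • ρ + ((1 - p : ℝ) : ℂ) • σ) - p * f ρ - (1 - p) * f σ
  upper : ∀ p ∈ Set.Ioo (0 : ℝ) 1, ∀ ρ ∈ finiteEnergySet H, ∀ σ ∈ finiteEnergySet H,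
    f ((p : ℂ) • ρ + ((1 - p : ℝ) : ℂ) • σ) - p * f ρ - (1 - p) * f σ ≤ b p

/-- `B_f(E)`, the supremum of `|f|` over the states with energy at most `E`. -/
def supAbs (H : 𝓗 →ₗ.[ℂ] 𝓗) (f : (𝓗 →L[ℂ] 𝓗) → ℝ) (E : ℝ) : ℝ :=
  sSup ((fun ρ => |f ρ|) '' energySet H E)

/-- `B_f⁺(E)`, the supremum of `max {f, 0}` over the states with energy at most `E`. -/
def supPos (H : 𝓗 →ₗ.[ℂ] 𝓗) (f : (𝓗 →L[ℂ] 𝓗) → ℝ) (E : ℝ) : ℝ :=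
  sSup ((fun ρ => max (f ρ) 0) '' energySet H E)

/-- `B_f⁻(E)`, the supremum of `max {-f, 0}` over the states with energy at most `E`. -/
def supNeg (H : 𝓗 →ₗ.[ℂ] 𝓗) (f : (𝓗 →L[ℂ] 𝓗) → ℝ) (E : ℝ) : ℝ :=
  sSup ((fun ρ => max (-f ρ) 0) '' energySet H E)

/-- `√(2ε) D(E/ε) + (1 + √(2ε)) (a(r) + b(r))` with `r = √(2ε) / (1 + √(2ε))`. -/
def contBound (D a b : ℝ → ℝ) (E ε : ℝ) : ℝ :=
  √(2 * ε) * D (E / ε) +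
    (1 + √(2 * ε)) * (a (√(2 * ε) / (1 + √(2 * ε))) + b (√(2 * ε) / (1 + √(2 * ε))))

/-- Uniform continuity of `f` on the set `K` with respect to the trace norm. -/
def TraceNormUniformContinuousOn (f : (𝓗 →L[ℂ] 𝓗) → ℝ) (K : Set (𝓗 →L[ℂ] 𝓗)) : Prop :=
  ∀ η : ℝ, 0 < η → ∃ δ : ℝ, 0 < δ ∧ ∀ ρ ∈ K, ∀ σ ∈ K,
    traceNorm (ρ - σ) < ENNReal.ofReal δ → |f ρ - f σ| < η

end QState

end

/-!
Continuity bounds for locally almost affine functions on states of bounded energy.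

Let `ρ`, `σ` be states of energy at most `E`, and suppose that they have purifications of overlap
`√(1 - δ²)`. The difference of two such pure states is `δ (τ̂₊ - τ̂₋)`, where `τ̂₊`, `τ̂₋` are pure
states given by vectors in the span of the purifying vectors; this makes the energy of `τ̂₊`, `τ̂₋`
at most `2 E / δ²`. Reduced to the original system, `ρ - σ = δ (τ₊ - τ₋)` with `τ₊`, `τ₋` of energy
at most `2 E / δ²`, so that `ρ + δ τ₋ = σ + δ τ₊`. Evaluating `f` on this operator, divided by
`1 + δ`, in two ways gives the Alicki–Fannes–Winter estimate `IsLAA.sub_le`.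

No tensor products are needed. A purification of `ρ` is an operator `X` with `X X* = ρ`, the two
reduced states are
`τ± = ((1 ± δ) ρ + (1 ∓ δ) σ - K) / (2 δ²)`, with `K = √(1 - δ²) (X Y* + Y X*)`,
and their positivity, trace and energy only depend on the quadratic form and the trace of the cross
term `C = X Y* + Y X*` (`IsCrossTerm`, `combine_mem_energySet`). If the overlap of `X` and `Y` is
larger than `√(1 - δ²)`, scaling `C` down amounts to a purification of `σ` in a larger space. Hence
the bound holds for `δ` equal to any upper bound of the distance, although it need not be monotone
in `δ`.

It remains to bound the overlap from below by the trace norm. For general states `X = ρ^(1/2)`,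
`Y = σ^(1/2)`, and the Powers–Størmer inequality `‖X - Y‖₂² ≤ ‖X² - Y²‖₁` gives an overlap of at
least `1 - ε ≥ √(1 - 2 ε)` (`exists_isCrossTerm`). It is proved in an eigenbasis of the
Hilbert–Schmidt, hence compact, operator `X - Y`. For pure states the overlap is `|⟨ψ, φ⟩|`, and an
eigenvector of `|φ⟩⟨φ| - |ψ⟩⟨ψ|` shows that it is at least `√(1 - ε²)`
(`exists_isCrossTerm_of_isPure`), so that here `δ = ε`.

The energy is a supremum of the traces `Tr A ρ` over positive bounded truncations `A` of `H`; all
that is used of it is its monotonicity and subadditivity (`energy_le_of_form_le`).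
-/

namespace QState

universe u v

variable {𝓗 : Type u} [NormedAddCommGroup 𝓗] [InnerProductSpace ℂ 𝓗] [CompleteSpace 𝓗]
variable {ι κ : Type*}

set_option linter.unusedSectionVars false

/-! ### Traces in an arbitrary orthonormal basis -/

theorem enorm_sq_eq_ofReal (x : 𝓗) : ‖x‖ₑ ^ 2 = ENNReal.ofReal (‖x‖ ^ 2) := by
  rw [ENNReal.ofReal_pow (norm_nonneg x), ofReal_norm]

theorem hasSum_norm_inner_sq (b : HilbertBasis ι ℂ 𝓗) (x : 𝓗) :
    HasSum (fun i => ‖⟪b i, x⟫_ℂ‖ ^ 2) (‖x‖ ^ 2) := by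
  have h := (b.hasSum_inner_mul_inner x x).mapL Complex.reCLM
  have e : Complex.reCLM ⟪x, x⟫_ℂ = ‖x‖ ^ 2 := by
    simpa using inner_self_eq_norm_sq (𝕜 := ℂ) x
  rw [e] at h
  convert h using 2 with i
  rw [← inner_conj_symm x (b i), RCLike.conj_mul]
  simp [← Complex.ofReal_pow]

theorem enorm_sq_eq_tsum_inner (b : HilbertBasis ι ℂ 𝓗) (x : 𝓗) :
    ‖x‖ₑ ^ 2 = ∑' i, ‖⟪b i, x⟫_ℂ‖ₑ ^ 2 := by
  have h := hasSum_norm_inner_sq b x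
  rw [enorm_sq_eq_ofReal, ← h.tsum_eq,
    ENNReal.ofReal_tsum_of_nonneg (fun i => by positivity) h.summable]
  exact tsum_congr fun i => (enorm_sq_eq_ofReal _).symm

theorem tsum_enorm_sq_star (b : HilbertBasis ι ℂ 𝓗) (b' : HilbertBasis κ ℂ 𝓗) (T : 𝓗 →L[ℂ] 𝓗) :
    ∑' i, ‖T (b i)‖ₑ ^ 2 = ∑' j, ‖star T (b' j)‖ₑ ^ 2 := by
  simp_rw [enorm_sq_eq_tsum_inner b' (T _), enorm_sq_eq_tsum_inner b (star T _)]
  rw [ENNReal.tsum_comm]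
  refine tsum_congr fun j => tsum_congr fun i => ?_
  rw [ContinuousLinearMap.star_eq_adjoint, ContinuousLinearMap.adjoint_inner_right,
    ← inner_conj_symm, RCLike.enorm_conj]

theorem re_inner_star_mul_self (T : 𝓗 →L[ℂ] 𝓗) (x : 𝓗) :
    (⟪x, (star T * T) x⟫_ℂ).re = ‖T x‖ ^ 2 := by
  rw [mul_apply_eq_comp, ContinuousLinearMap.star_eq_adjoint,
    ContinuousLinearMap.adjoint_inner_right]
  simpa using inner_self_eq_norm_sq (𝕜 := ℂ) (T x)

theorem re_inner_nonneg {A : 𝓗 →L[ℂ] 𝓗} (hA : A.IsPositive) (x : 𝓗) : 0 ≤ (⟪x, A x⟫_ℂ).re :=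
  hA.re_inner_nonneg_right x

/-- `Tr T* T` is the square of the Hilbert–Schmidt norm of `T`, computed in any basis. -/
theorem posTrace_star_mul_self (b : HilbertBasis ι ℂ 𝓗) (T : 𝓗 →L[ℂ] 𝓗) :
    posTrace (star T * T) = ∑' i, ‖T (b i)‖ₑ ^ 2 := by
  rw [tsum_enorm_sq_star b (onb 𝓗), ← tsum_enorm_sq_star (onb 𝓗) (onb 𝓗)]
  refine tsum_congr fun i => ?_
  rw [re_inner_star_mul_self, enorm_sq_eq_ofReal]

theorem posTrace_star_mul_self_comm (T : 𝓗 →L[ℂ] 𝓗) :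
    posTrace (star T * T) = posTrace (T * star T) := by
  have h := posTrace_star_mul_self (onb 𝓗) (star T)
  rw [star_star] at h
  rw [h, posTrace_star_mul_self (onb 𝓗), tsum_enorm_sq_star]

theorem star_sqrt (A : 𝓗 →L[ℂ] 𝓗) : star (CFC.sqrt A) = CFC.sqrt A :=
  (IsSelfAdjoint.of_nonneg (CFC.sqrt_nonneg A)).star_eq

theorem sqrt_mul_sqrt {A : 𝓗 →L[ℂ] 𝓗} (hA : A.IsPositive) : CFC.sqrt A * CFC.sqrt A = A :=
  CFC.sqrt_mul_sqrt_self A (A.nonneg_iff_isPositive.2 hA)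

theorem re_inner_eq_norm_sqrt_sq {A : 𝓗 →L[ℂ] 𝓗} (hA : A.IsPositive) (x : 𝓗) :
    (⟪x, A x⟫_ℂ).re = ‖CFC.sqrt A x‖ ^ 2 := by
  rw [← re_inner_star_mul_self, star_sqrt, sqrt_mul_sqrt hA]

theorem posTrace_eq_tsum {A : 𝓗 →L[ℂ] 𝓗} (hA : A.IsPositive) (b : HilbertBasis ι ℂ 𝓗) :
    posTrace A = ∑' i, ENNReal.ofReal (⟪b i, A (b i)⟫_ℂ).re := by
  have h := posTrace_star_mul_self b (CFC.sqrt A)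
  rw [star_sqrt, sqrt_mul_sqrt hA] at h
  rw [h]
  exact tsum_congr fun i => by rw [re_inner_eq_norm_sqrt_sq hA, enorm_sq_eq_ofReal]

/-- `Tr ρ^(1/2) A ρ^(1/2) = Tr A^(1/2) ρ A^(1/2)`; the right-hand side is additive in `ρ`. -/
theorem traceMul_eq_tsum {A ρ : 𝓗 →L[ℂ] 𝓗} (hA : A.IsPositive) (hρ : ρ.IsPositive) :
    traceMul A ρ = ∑' i, ENNReal.ofReal
      (⟪CFC.sqrt A (onb 𝓗 i), ρ (CFC.sqrt A (onb 𝓗 i))⟫_ℂ).re := by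
  have h := posTrace_star_mul_self_comm (CFC.sqrt A * CFC.sqrt ρ)
  have e : ∀ R S : 𝓗 →L[ℂ] 𝓗, R * S * (S * R) = R * (S * S) * R := fun R S => by
    simp only [mul_assoc]
  rw [star_mul, star_sqrt, star_sqrt, e, e, sqrt_mul_sqrt hA, sqrt_mul_sqrt hρ] at h
  rw [traceMul, h]
  refine tsum_congr fun i => ?_
  rw [mul_apply_eq_comp, mul_apply_eq_comp,
    ← ContinuousLinearMap.adjoint_inner_left, ← ContinuousLinearMap.star_eq_adjoint, star_sqrt]

theorem traceMul_le_of_form_le {A ρ σ τ : 𝓗 →L[ℂ] 𝓗} (hA : A.IsPositive) (hρ : ρ.IsPositive)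
    (hσ : σ.IsPositive) (hτ : τ.IsPositive) {u v : ℝ} (hu : 0 ≤ u) (hv : 0 ≤ v)
    (h : ∀ x, (⟪x, τ x⟫_ℂ).re ≤ u * (⟪x, ρ x⟫_ℂ).re + v * (⟪x, σ x⟫_ℂ).re) :
    traceMul A τ ≤ ENNReal.ofReal u * traceMul A ρ + ENNReal.ofReal v * traceMul A σ := by
  rw [traceMul_eq_tsum hA hρ, traceMul_eq_tsum hA hσ, traceMul_eq_tsum hA hτ,
    ← ENNReal.tsum_mul_left, ← ENNReal.tsum_mul_left, ← ENNReal.tsum_add]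
  refine ENNReal.tsum_le_tsum fun i => ?_
  rw [← ENNReal.ofReal_mul hu, ← ENNReal.ofReal_mul hv,
    ← ENNReal.ofReal_add (mul_nonneg hu (re_inner_nonneg hρ _))
      (mul_nonneg hv (re_inner_nonneg hσ _))]
  exact ENNReal.ofReal_le_ofReal (h _)

theorem IsState.hasSum {ρ : 𝓗 →L[ℂ] 𝓗} (hρ : IsState ρ) (b : HilbertBasis ι ℂ 𝓗) :
    HasSum (fun i => (⟪b i, ρ (b i)⟫_ℂ).re) 1 := by
  have h := hρ.2
  rw [posTrace_eq_tsum hρ.1 b] at h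
  have h0 : ∀ i, 0 ≤ (⟪b i, ρ (b i)⟫_ℂ).re := fun i => re_inner_nonneg hρ.1 _
  have := ENNReal.hasSum_toReal (f := fun i => ENNReal.ofReal (⟪b i, ρ (b i)⟫_ℂ).re)
    (by rw [h]; simp)
  simp only [ENNReal.toReal_ofReal (h0 _)] at this
  have e := ENNReal.tsum_toReal_eq (f := fun i => ENNReal.ofReal (⟪b i, ρ (b i)⟫_ℂ).re)
    (fun i => ENNReal.ofReal_ne_top)
  simp only [ENNReal.toReal_ofReal (h0 _), h, ENNReal.toReal_one] at e
  rwa [← e] at this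

theorem isState_of_hasSum {ρ : 𝓗 →L[ℂ] 𝓗} (hρ : ρ.IsPositive)
    (h : HasSum (fun i => (⟪onb 𝓗 i, ρ (onb 𝓗 i)⟫_ℂ).re) 1) : IsState ρ := by
  refine ⟨hρ, ?_⟩
  rw [posTrace, ← ENNReal.ofReal_tsum_of_nonneg (fun i => re_inner_nonneg hρ _) h.summable,
    h.tsum_eq, ENNReal.ofReal_one]

/-! ### The energy -/

theorem IsTruncation.isPositive {H : 𝓗 →ₗ.[ℂ] 𝓗} (hH : IsHamiltonian H) {n : ℕ}
    {A : 𝓗 →L[ℂ] 𝓗} (hA : IsTruncation H n A) : A.IsPositive := by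
  obtain ⟨P, ⟨S, hS, hP⟩, hAP⟩ := hA
  have hsa : star P = P := hP ▸ (S.isStarProjection _ measurableSet_Icc).isSelfAdjoint.star_eq
  rw [ContinuousLinearMap.isPositive_iff_complex]
  intro x
  obtain ⟨hx, hAx⟩ := hAP x
  have e : ⟪A x, x⟫_ℂ = starRingEnd ℂ ⟪P x, H ⟨P x, hx⟩⟫_ℂ := by
    rw [hAx, inner_conj_symm]
    nth_rw 1 [← hsa]
    rw [ContinuousLinearMap.star_eq_adjoint, ContinuousLinearMap.adjoint_inner_left]
  have h1 := hS.inner_apply ⟨P x, hx⟩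
  have h2 := hH.2 ⟨P x, hx⟩
  simp only at h1 h2
  rw [e]
  rw [h1] at h2 ⊢
  simpa using h2

theorem energy_le_of_form_le {H : 𝓗 →ₗ.[ℂ] 𝓗} (hH : IsHamiltonian H) {ρ σ τ : 𝓗 →L[ℂ] 𝓗}
    (hρ : ρ.IsPositive) (hσ : σ.IsPositive) (hτ : τ.IsPositive) {u v : ℝ} (hu : 0 ≤ u)
    (hv : 0 ≤ v) (h : ∀ x, (⟪x, τ x⟫_ℂ).re ≤ u * (⟪x, ρ x⟫_ℂ).re + v * (⟪x, σ x⟫_ℂ).re) :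
    energy H τ ≤ ENNReal.ofReal u * energy H ρ + ENNReal.ofReal v * energy H σ := by
  have le (n : ℕ) (A : 𝓗 →L[ℂ] 𝓗) (hA : IsTruncation H n A) (ω : 𝓗 →L[ℂ] 𝓗) :
      traceMul A ω ≤ energy H ω :=
    le_iSup_of_le n (le_iSup₂_of_le A hA le_rfl)
  refine iSup_le fun n => iSup₂_le fun A hA => ?_
  refine (traceMul_le_of_form_le (hA.isPositive hH) hρ hσ hτ hu hv h).trans ?_
  gcongr <;> exact le n A hA _

theorem groundEnergy_nonneg {H : 𝓗 →ₗ.[ℂ] 𝓗} (hH : IsHamiltonian H) : 0 ≤ groundEnergy H := by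
  refine Real.sInf_nonneg ?_
  rintro r ⟨φ, -, rfl⟩
  exact hH.2 φ

theorem energySet_mono (H : 𝓗 →ₗ.[ℂ] 𝓗) : Monotone (energySet H) :=
  fun _ _ h _ hρ => ⟨hρ.1, hρ.2.trans (ENNReal.ofReal_le_ofReal h)⟩

/-! ### States built from a cross term -/

/-- `C` behaves like the cross term `X Y* + Y X*` of two operators with `X X* = ρ`, `Y Y* = σ`:
it is self-adjoint, obeys the Cauchy–Schwarz bound, and has trace `2 c`. The number `c` is the
overlap `Re ⟨X, Y⟩` of the two purifications `X`, `Y`, regarded as Hilbert–Schmidt operators. -/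
structure IsCrossTerm (ρ σ C : 𝓗 →L[ℂ] 𝓗) (c : ℝ) : Prop where
  isSelfAdjoint : IsSelfAdjoint C
  sq_le : ∀ x, (⟪x, C x⟫_ℂ).re ^ 2 ≤ 4 * (⟪x, ρ x⟫_ℂ).re * (⟪x, σ x⟫_ℂ).re
  hasSum : HasSum (fun i => (⟪onb 𝓗 i, C (onb 𝓗 i)⟫_ℂ).re) (2 * c)

theorem IsCrossTerm.symm {ρ σ C : 𝓗 →L[ℂ] 𝓗} {c : ℝ} (h : IsCrossTerm ρ σ C c) :
    IsCrossTerm σ ρ C c :=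
  ⟨h.isSelfAdjoint, fun x => (h.sq_le x).trans_eq (by ring), h.hasSum⟩

/-- The real combination `u ρ + v σ - w C`. -/
def combine (u v w : ℝ) (ρ σ C : 𝓗 →L[ℂ] 𝓗) : 𝓗 →L[ℂ] 𝓗 :=
  (u : ℂ) • ρ + (v : ℂ) • σ - (w : ℂ) • C

theorem re_inner_combine (u v w : ℝ) (ρ σ C : 𝓗 →L[ℂ] 𝓗) (x : 𝓗) :
    (⟪x, combine u v w ρ σ C x⟫_ℂ).re =
      u * (⟪x, ρ x⟫_ℂ).re + v * (⟪x, σ x⟫_ℂ).re - w * (⟪x, C x⟫_ℂ).re := by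
  simp [combine]

theorem isSelfAdjoint_combine (u v w : ℝ) {ρ σ C : 𝓗 →L[ℂ] 𝓗} (hρ : IsSelfAdjoint ρ)
    (hσ : IsSelfAdjoint σ) (hC : IsSelfAdjoint C) : IsSelfAdjoint (combine u v w ρ σ C) := by
  have h (r : ℝ) : IsSelfAdjoint (r : ℂ) := Complex.conj_ofReal r
  exact (((h u).smul hρ).add ((h v).smul hσ)).sub ((h w).smul hC)

theorem isPositive_of_re_inner_nonneg {A : 𝓗 →L[ℂ] 𝓗} (hA : IsSelfAdjoint A)
    (h : ∀ x, 0 ≤ (⟪x, A x⟫_ℂ).re) : A.IsPositive := by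
  refine ContinuousLinearMap.isPositive_def'.2 ⟨hA, fun x => ?_⟩
  rw [ContinuousLinearMap.reApplyInnerSelf_apply, inner_re_symm]
  exact h x

/-- With `δ² = s²`, these are (for `s = δ` and `s = -δ`) the normalized positive and negative
parts of the difference of two purifications of `ρ` and `σ` with overlap `√(1 - δ²)`, reduced to
the original system. The overlap `c` of the given cross term is lowered to `√(1 - δ²)` by scaling
`C`; this needs `1 ≤ s² + c²`. -/
theorem combine_mem_energySet {H : 𝓗 →ₗ.[ℂ] 𝓗} (hH : IsHamiltonian H) {E : ℝ} (hE : 0 ≤ E)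
    {ρ σ C : 𝓗 →L[ℂ] 𝓗} (hρ : ρ ∈ energySet H E) (hσ : σ ∈ energySet H E) {c s : ℝ}
    (hC : IsCrossTerm ρ σ C c) (hc : 0 ≤ c) (hs : s ≠ 0) (hs1 : s ^ 2 ≤ 1)
    (hcs : 1 ≤ s ^ 2 + c ^ 2) :
    combine ((1 + s) / (2 * s ^ 2)) ((1 - s) / (2 * s ^ 2)) ((1 - s ^ 2) / c / (2 * s ^ 2)) ρ σ C
      ∈ energySet H (2 * E / s ^ 2) := by
  have hs2 : 0 < s ^ 2 := by positivity
  obtain ⟨hsl, hsu⟩ := abs_le.1 ((sq_le_one_iff_abs_le_one s).1 hs1)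
  set w := (1 - s ^ 2) / c with hw
  -- `w = 0 / 0 = 0` when `c = 0`
  have hwc : w * c = 1 - s ^ 2 := by
    rcases hc.eq_or_lt with h0 | h0
    · have : s ^ 2 = 1 := by subst h0; nlinarith
      rw [hw, this]; simp
    · rw [hw]; field_simp
  have hw2 : w ^ 2 ≤ 1 - s ^ 2 := by
    rcases hc.eq_or_lt with h0 | h0
    · rw [hw, ← h0]; simpa using hs1
    · rw [hw, div_pow, div_le_iff₀ (by positivity)]; nlinarith
  clear_value w
  have hdiff (x : 𝓗) : (w * (⟪x, C x⟫_ℂ).re) ^ 2 ≤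
      4 * (1 - s ^ 2) * (⟪x, ρ x⟫_ℂ).re * (⟪x, σ x⟫_ℂ).re := by
    have h1 := hC.sq_le x
    have h2 : 0 ≤ 4 * (⟪x, ρ x⟫_ℂ).re * (⟪x, σ x⟫_ℂ).re := (sq_nonneg _).trans h1
    rw [mul_pow]
    calc w ^ 2 * (⟪x, C x⟫_ℂ).re ^ 2
        ≤ (1 - s ^ 2) * (4 * (⟪x, ρ x⟫_ℂ).re * (⟪x, σ x⟫_ℂ).re) := by gcongr
      _ = _ := by ring
  have hform (x : 𝓗) : (⟪x, combine ((1 + s) / (2 * s ^ 2)) ((1 - s) / (2 * s ^ 2))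
      (w / (2 * s ^ 2)) ρ σ C x⟫_ℂ).re = ((1 + s) * (⟪x, ρ x⟫_ℂ).re + (1 - s) * (⟪x, σ x⟫_ℂ).re
        - w * (⟪x, C x⟫_ℂ).re) / (2 * s ^ 2) := by
    rw [re_inner_combine]; ring
  have hpos : (combine ((1 + s) / (2 * s ^ 2)) ((1 - s) / (2 * s ^ 2))
      (w / (2 * s ^ 2)) ρ σ C).IsPositive := by
    refine isPositive_of_re_inner_nonneg (isSelfAdjoint_combine _ _ _ hρ.1.1.isSelfAdjoint
      hσ.1.1.isSelfAdjoint hC.isSelfAdjoint) fun x => ?_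
    rw [hform]
    have h1 := re_inner_nonneg hρ.1.1 x
    have h2 := re_inner_nonneg hσ.1.1 x
    have h3 := hdiff x
    refine div_nonneg (sub_nonneg.2 ?_) (by positivity)
    refine le_of_abs_le (abs_le_of_sq_le_sq ?_ ?_)
    · nlinarith [sq_nonneg ((1 + s) * (⟪x, ρ x⟫_ℂ).re - (1 - s) * (⟪x, σ x⟫_ℂ).re)]
    · exact add_nonneg (mul_nonneg (by linarith) h1) (mul_nonneg (by linarith) h2)
  refine ⟨isState_of_hasSum hpos ?_, ?_⟩
  · have h := (((hρ.1.hasSum (onb 𝓗)).mul_left (1 + s)).add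
      ((hσ.1.hasSum (onb 𝓗)).mul_left (1 - s))).sub (hC.hasSum.mul_left w)
    have h' := h.div_const (2 * s ^ 2)
    have e : ((1 + s) * 1 + (1 - s) * 1 - w * (2 * c)) / (2 * s ^ 2) = 1 := by
      rw [div_eq_one_iff_eq (by positivity)]; linarith
    rw [e] at h'
    refine h'.congr_fun fun i => ?_
    rw [hform]
  · refine (energy_le_of_form_le hH hρ.1.1 hσ.1.1 hpos (u := (2 + s) / (2 * s ^ 2))
      (v := (2 - s) / (2 * s ^ 2)) (div_nonneg (by linarith) (by positivity))
      (div_nonneg (by linarith) (by positivity)) fun x => ?_).trans ?_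
    · rw [hform]
      have h1 := re_inner_nonneg hρ.1.1 x
      have h2 := re_inner_nonneg hσ.1.1 x
      have h3 := hdiff x
      have h4 := mul_nonneg h1 h2
      have h5 : |w * (⟪x, C x⟫_ℂ).re| ≤ (⟪x, ρ x⟫_ℂ).re + (⟪x, σ x⟫_ℂ).re := by
        refine abs_le_of_sq_le_sq ?_ (by linarith)
        nlinarith [sq_nonneg ((⟪x, ρ x⟫_ℂ).re - (⟪x, σ x⟫_ℂ).re), mul_nonneg hs2.le h4]
      have h6 := (abs_le.1 h5).1
      rw [div_mul_eq_mul_div (2 + s), div_mul_eq_mul_div (2 - s), ← add_div]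
      gcongr
      linarith
    · calc _ ≤ ENNReal.ofReal ((2 + s) / (2 * s ^ 2)) * ENNReal.ofReal E +
            ENNReal.ofReal ((2 - s) / (2 * s ^ 2)) * ENNReal.ofReal E := by
            gcongr
            · exact hρ.2
            · exact hσ.2
        _ = ENNReal.ofReal (2 * E / s ^ 2) := by
            have h1 : 0 ≤ (2 + s) / (2 * s ^ 2) := div_nonneg (by linarith) (by positivity)
            have h2 : 0 ≤ (2 - s) / (2 * s ^ 2) := div_nonneg (by linarith) (by positivity)
            rw [← ENNReal.ofReal_mul h1, ← ENNReal.ofReal_mul h2,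
              ← ENNReal.ofReal_add (mul_nonneg h1 hE) (mul_nonneg h2 hE)]
            congr 1
            field_simp
            ring

/-! ### The Alicki–Fannes–Winter estimate -/

theorem IsLAA.sub_le {H : 𝓗 →ₗ.[ℂ] 𝓗} {f : (𝓗 →L[ℂ] 𝓗) → ℝ} {a b : ℝ → ℝ} (hf : IsLAA H f a b)
    {ρ σ τ τ' : 𝓗 →L[ℂ] 𝓗} (hρ : ρ ∈ finiteEnergySet H) (hσ : σ ∈ finiteEnergySet H)
    (hτ : τ ∈ finiteEnergySet H) (hτ' : τ' ∈ finiteEnergySet H) {δ : ℝ} (hδ : 0 < δ)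
    (h : ρ - σ = (δ : ℂ) • (τ - τ')) :
    f ρ - f σ ≤ δ * (f τ - f τ') + (1 + δ) * (a (δ / (1 + δ)) + b (δ / (1 + δ))) := by
  set p := δ / (1 + δ) with hp
  have hp1 : 1 - p = 1 / (1 + δ) := by rw [hp]; field_simp; ring
  have hp01 : p ∈ Set.Ioo (0 : ℝ) 1 :=
    ⟨by positivity, by rw [hp, div_lt_one (by positivity)]; linarith⟩
  have e : (p : ℂ) • τ' + ((1 - p : ℝ) : ℂ) • ρ = (p : ℂ) • τ + ((1 - p : ℝ) : ℂ) • σ := by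
    have hpd : p = (1 - p) * δ := by rw [hp1, hp]; ring
    have hpd' : (p : ℂ) = ((1 - p : ℝ) : ℂ) * (δ : ℂ) := by exact_mod_cast hpd
    have : ρ = σ + (δ : ℂ) • (τ - τ') := by rw [← h]; abel
    rw [this, smul_add, smul_smul, ← hpd', smul_sub]
    abel
  have hl := hf.lower p hp01 τ' hτ' ρ hρ
  have hu := hf.upper p hp01 τ hτ σ hσ
  rw [e] at hl
  have key : (1 - p) * (f ρ - f σ) ≤ p * (f τ - f τ') + (a p + b p) := by linarith
  rw [hp1] at key
  have := mul_le_mul_of_nonneg_left key (by positivity : 0 ≤ 1 + δ)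
  calc f ρ - f σ = (1 + δ) * (1 / (1 + δ) * (f ρ - f σ)) := by field_simp
    _ ≤ _ := this
    _ = _ := by rw [mul_add, hp]; field_simp

/-- Two states of energy at most `E` with purifications of overlap at least `√(1 - δ²)`. -/
theorem IsCrossTerm.sub_le {H : 𝓗 →ₗ.[ℂ] 𝓗} (hH : IsHamiltonian H)
    {f : (𝓗 →L[ℂ] 𝓗) → ℝ} {a b : ℝ → ℝ} (hf : IsLAA H f a b)
    (hB : ∀ E : ℝ, groundEnergy H ≤ E → BddAbove ((fun ρ => |f ρ|) '' energySet H E))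
    {E : ℝ} (hE : groundEnergy H ≤ E) {ρ σ C : 𝓗 →L[ℂ] 𝓗} (hρ : ρ ∈ energySet H E)
    (hσ : σ ∈ energySet H E) {c δ : ℝ} (hC : IsCrossTerm ρ σ C c) (hc : 0 ≤ c) (hδ : 0 < δ)
    (hδ1 : δ ≤ 1) (hcδ : 1 ≤ δ ^ 2 + c ^ 2) :
    f ρ - f σ ≤ δ * (supPos H f (2 * E / δ ^ 2) + supNeg H f (2 * E / δ ^ 2)) +
      (1 + δ) * (a (δ / (1 + δ)) + b (δ / (1 + δ))) := by
  have hE0 : 0 ≤ E := (groundEnergy_nonneg hH).trans hE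
  have hδ2 : δ ^ 2 ≤ 1 := pow_le_one₀ hδ.le hδ1
  have hEE : E ≤ 2 * E / δ ^ 2 := by
    rw [le_div_iff₀ (by positivity)]; nlinarith
  have hg := hE.trans hEE
  have hp := combine_mem_energySet hH hE0 hρ hσ hC hc hδ.ne' hδ2 hcδ
  have hm := combine_mem_energySet hH hE0 hρ hσ hC hc (neg_ne_zero.2 hδ.ne')
    (by rwa [neg_sq]) (by rwa [neg_sq])
  simp only [neg_sq, sub_neg_eq_add, ← sub_eq_add_neg] at hm
  have hd : ρ - σ = (δ : ℂ) •
      (combine ((1 + δ) / (2 * δ ^ 2)) ((1 - δ) / (2 * δ ^ 2)) ((1 - δ ^ 2) / c / (2 * δ ^ 2))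
        ρ σ C -
      combine ((1 - δ) / (2 * δ ^ 2)) ((1 + δ) / (2 * δ ^ 2)) ((1 - δ ^ 2) / c / (2 * δ ^ 2))
        ρ σ C) := by
    have hr : δ * ((1 + δ) / (2 * δ ^ 2)) - δ * ((1 - δ) / (2 * δ ^ 2)) = 1 := by
      field_simp; ring
    have hr' : (δ : ℂ) * (((1 + δ) / (2 * δ ^ 2) : ℝ) : ℂ) -
        (δ : ℂ) * (((1 - δ) / (2 * δ ^ 2) : ℝ) : ℂ) = 1 := by exact_mod_cast hr
    simp only [combine]
    calc ρ - σ = (1 : ℂ) • ρ - (1 : ℂ) • σ := by simp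
      _ = _ := by rw [← hr']; module
  refine (hf.sub_le ⟨E, hE, hρ⟩ ⟨E, hE, hσ⟩ ⟨_, hg, hp⟩ ⟨_, hg, hm⟩ hδ hd).trans ?_
  obtain ⟨M, hM⟩ := hB _ hg
  have h1 : f _ ≤ supPos H f (2 * E / δ ^ 2) := (le_max_left _ 0).trans
    (le_csSup ⟨M, by
      rintro _ ⟨ω, hω, rfl⟩
      have := hM ⟨ω, hω, rfl⟩
      exact max_le ((le_abs_self _).trans this) ((abs_nonneg _).trans this)⟩ ⟨_, hp, rfl⟩)
  have h2 : -f _ ≤ supNeg H f (2 * E / δ ^ 2) := (le_max_left _ 0).trans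
    (le_csSup ⟨M, by
      rintro _ ⟨ω, hω, rfl⟩
      have := hM ⟨ω, hω, rfl⟩
      exact max_le ((neg_le_abs _).trans this) ((abs_nonneg _).trans this)⟩ ⟨_, hm, rfl⟩)
  gcongr
  linarith

theorem supPos_add_supNeg_le {H : 𝓗 →ₗ.[ℂ] 𝓗} {f : (𝓗 →L[ℂ] 𝓗) → ℝ} {E : ℝ}
    (hB : BddAbove ((fun ρ => |f ρ|) '' energySet H E)) :
    supPos H f E + supNeg H f E ≤ 2 * supAbs H f E := by
  have h0 : 0 ≤ supAbs H f E := Real.sSup_nonneg (by rintro _ ⟨ω, -, rfl⟩; exact abs_nonneg _)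
  have h (ω : 𝓗 →L[ℂ] 𝓗) (hω : ω ∈ energySet H E) : |f ω| ≤ supAbs H f E :=
    le_csSup hB ⟨ω, hω, rfl⟩
  have h1 : supPos H f E ≤ supAbs H f E := Real.sSup_le (by
    rintro _ ⟨ω, hω, rfl⟩
    exact max_le ((le_abs_self _).trans (h ω hω)) h0) h0
  have h2 : supNeg H f E ≤ supAbs H f E := Real.sSup_le (by
    rintro _ ⟨ω, hω, rfl⟩
    exact max_le ((neg_le_abs _).trans (h ω hω)) h0) h0
  linarith

theorem IsCrossTerm.abs_sub_le {H : 𝓗 →ₗ.[ℂ] 𝓗} (hH : IsHamiltonian H)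
    {f : (𝓗 →L[ℂ] 𝓗) → ℝ} {a b : ℝ → ℝ} (hf : IsLAA H f a b)
    (hB : ∀ E : ℝ, groundEnergy H ≤ E → BddAbove ((fun ρ => |f ρ|) '' energySet H E))
    {E : ℝ} (hE : groundEnergy H ≤ E) {ρ σ C : 𝓗 →L[ℂ] 𝓗} (hρ : ρ ∈ energySet H E)
    (hσ : σ ∈ energySet H E) {c ε : ℝ} (hC : IsCrossTerm ρ σ C c) (hc : 0 ≤ c) (hε : 0 < ε)
    (hε1 : ε ≤ 1 / 2) (hcε : 1 ≤ 2 * ε + c ^ 2) :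
    |f ρ - f σ| ≤ contBound (fun t => 2 * supAbs H f t) a b E ε ∧
    |f ρ - f σ| ≤ contBound (fun t => supPos H f t + supNeg H f t) a b E ε := by
  have hδ : 0 < √(2 * ε) := by positivity
  have hδ2 : √(2 * ε) ^ 2 = 2 * ε := Real.sq_sqrt (by positivity)
  have hδ1 : √(2 * ε) ≤ 1 := Real.sqrt_le_one.2 (by linarith)
  have hEε : 2 * E / √(2 * ε) ^ 2 = E / ε := by rw [hδ2]; field_simp
  have hgE : groundEnergy H ≤ E / ε := by
    refine hE.trans ?_
    have := (groundEnergy_nonneg hH).trans hE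
    rw [le_div_iff₀ hε]; nlinarith
  have key : |f ρ - f σ| ≤ contBound (fun t => supPos H f t + supNeg H f t) a b E ε := by
    rw [contBound, ← hEε]
    refine abs_sub_le_iff.2 ⟨?_, ?_⟩
    · exact hC.sub_le hH hf hB hE hρ hσ hc hδ hδ1 (by rwa [hδ2])
    · exact hC.symm.sub_le hH hf hB hE hσ hρ hc hδ hδ1 (by rwa [hδ2])
  refine ⟨key.trans ?_, key⟩
  rw [contBound, contBound]
  gcongr
  exact supPos_add_supNeg_le (hB _ hgE)

/-! ### Hilbert–Schmidt operators and their eigenbases -/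

theorem enorm_apply_sq_le (b : HilbertBasis ι ℂ 𝓗) (T : 𝓗 →L[ℂ] 𝓗) (x : 𝓗) :
    ‖T x‖ₑ ^ 2 ≤ (∑' i, ‖T (b i)‖ₑ ^ 2) * ‖x‖ₑ ^ 2 := by
  rw [tsum_enorm_sq_star b b, enorm_sq_eq_tsum_inner b, ← ENNReal.tsum_mul_right]
  refine ENNReal.tsum_le_tsum fun i => ?_
  rw [ContinuousLinearMap.star_eq_adjoint, ← ContinuousLinearMap.adjoint_inner_left, ← mul_pow]
  gcongr
  rw [← ofReal_norm, ← ofReal_norm, ← ofReal_norm, ← ENNReal.ofReal_mul (norm_nonneg _)]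
  exact ENNReal.ofReal_le_ofReal (norm_inner_le_norm _ _)

theorem isCompactOperator_rankOne (x y : 𝓗) :
    IsCompactOperator (InnerProductSpace.rankOne ℂ x y) := by
  have h : IsCompactOperator (id : ℂ → ℂ) :=
    (isCompactOperator_id_iff_finiteDimensional (𝕜 := ℂ)).2 inferInstance
  exact (h.clm_comp (ContinuousLinearMap.toSpanSingleton ℂ x)).comp_clm (innerSL ℂ y)

theorem isCompactOperator_of_tsum_ne_top (b : HilbertBasis ι ℂ 𝓗) {T : 𝓗 →L[ℂ] 𝓗}
    (hT : ∑' i, ‖T (b i)‖ₑ ^ 2 ≠ ⊤) : IsCompactOperator T := by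
  classical
  let F : Finset ι → 𝓗 →L[ℂ] 𝓗 := fun s =>
    ∑ i ∈ s, InnerProductSpace.rankOne ℂ (T (b i)) (b i)
  have hF (s : Finset ι) : IsCompactOperator (F s) := by
    refine Finset.sum_induction _ (fun A : 𝓗 →L[ℂ] 𝓗 => IsCompactOperator A)
      (fun A B hA hB => hA.add hB) isCompactOperator_zero fun i _ => isCompactOperator_rankOne _ _
  have hFb (s : Finset ι) (i : ι) : F s (b i) = if i ∈ s then T (b i) else 0 := by
    simp only [F, sum_apply, InnerProductSpace.rankOne_apply,
      orthonormal_iff_ite.1 b.orthonormal, ite_smul, one_smul, zero_smul, Finset.sum_ite_eq']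
  have hsum (s : Finset ι) : ∑' i, ‖(T - F s) (b i)‖ₑ ^ 2 = ∑' i : {i // i ∉ s}, ‖T (b i)‖ₑ ^ 2 := by
    rw [← tsum_subtype_eq_of_support_subset (s := {i | i ∉ s})]
    · refine tsum_congr fun i => ?_
      have := i.2
      simp only [Set.mem_ofPred_eq] at this
      simp [hFb, this]
    · intro i hi
      contrapose! hi
      simp only [Set.mem_ofPred_eq, not_not] at hi
      simp [hFb, hi]
  have hlim : Tendsto F atTop (𝓝 T) := by
    rw [tendsto_iff_norm_sub_tendsto_zero]
    have h0 := ENNReal.tendsto_tsum_compl_atTop_zero hT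
    simp_rw [← hsum] at h0
    have htop (s : Finset ι) : ∑' i, ‖(T - F s) (b i)‖ₑ ^ 2 ≠ ⊤ := by
      rw [hsum]
      exact ne_top_of_le_ne_top hT (ENNReal.tsum_comp_le_tsum_of_injective
        Subtype.val_injective fun i => ‖T (b i)‖ₑ ^ 2)
    have h1 := ((ENNReal.tendsto_toReal ENNReal.zero_ne_top).comp h0).sqrt
    rw [ENNReal.toReal_zero, Real.sqrt_zero] at h1
    refine squeeze_zero (fun s => norm_nonneg _) (fun s => ?_) h1
    rw [norm_sub_rev]
    refine ContinuousLinearMap.opNorm_le_bound _ (Real.sqrt_nonneg _) fun x => ?_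
    have h2 := enorm_apply_sq_le b (T - F s) x
    rw [enorm_sq_eq_ofReal, enorm_sq_eq_ofReal, ← ENNReal.ofReal_toReal (htop s),
      ← ENNReal.ofReal_mul ENNReal.toReal_nonneg, ENNReal.ofReal_le_ofReal_iff (by positivity)] at h2
    refine le_of_sq_le_sq ?_ (by positivity)
    rw [mul_pow]
    simpa [Real.sq_sqrt] using h2
  exact isCompactOperator_of_tendsto hlim (Eventually.of_forall hF)

/-- Orthonormal bases of the members of a complete orthogonal family of closed subspaces
together form an orthonormal basis of the whole space. -/
theorem exists_hilbertBasis_of_orthogonalFamily {α : Type v} {V : α → Submodule ℂ 𝓗}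
    (hVc : ∀ i, CompleteSpace (V i))
    (hV : OrthogonalFamily ℂ (fun i => V i) fun i => (V i).subtypeₗᵢ) (htop : (⨆ i, V i)ᗮ = ⊥) :
    ∃ (κ : Type (max u v)) (b : HilbertBasis κ ℂ 𝓗), ∀ k, ∃ i, b k ∈ V i := by
  choose w e he using fun i => exists_hilbertBasis ℂ (V i)
  have hort := hV.orthonormal_sigma_orthonormal (fun i => (e i).orthonormal)
  have hbot : (Submodule.span ℂ
      (Set.range fun a : Σ i, w i => (V a.1).subtypeₗᵢ (e a.1 a.2)))ᗮ = ⊥ := by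
    rw [eq_bot_iff, ← htop]
    intro x hx
    rw [Submodule.mem_orthogonal'] at hx
    rw [← Submodule.iInf_orthogonal, Submodule.mem_iInf]
    intro i
    rw [Submodule.mem_orthogonal']
    intro y hy
    have h1 := (((e i).hasSum_repr ⟨y, hy⟩).mapL (V i).subtypeL).mapL (innerSL ℂ x)
    have h2 (j : w i) : ⟪x, (e i j : 𝓗)⟫_ℂ = 0 := hx _ (Submodule.subset_span ⟨⟨i, j⟩, rfl⟩)
    refine h1.unique (hasSum_zero.congr_fun fun j => ?_)
    simp [h2]
  refine ⟨_, HilbertBasis.mkOfOrthogonalEqBot hort hbot, fun a => ⟨a.1, ?_⟩⟩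
  rw [HilbertBasis.coe_mkOfOrthogonalEqBot]
  exact (e a.1 a.2).2

/-- An orthonormal basis diagonalizing a compact self-adjoint operator. -/
theorem exists_eigenbasis {D : 𝓗 →L[ℂ] 𝓗} (hD : IsCompactOperator D) (hsa : IsSelfAdjoint D) :
    ∃ (κ : Type u) (b : HilbertBasis κ ℂ 𝓗) (l : κ → ℝ), ∀ k, D (b k) = (l k : ℂ) • b k := by
  have hsym : D.IsSymmetric := hsa.isSymmetric
  have hVc (μ : ℂ) : CompleteSpace (Module.End.eigenspace (D : Module.End ℂ 𝓗) μ) := by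
    have : (Module.End.eigenspace (D : Module.End ℂ 𝓗) μ : Set 𝓗) = {x | D x = μ • x} := by
      ext x; exact Module.End.mem_eigenspace_iff
    refine @IsClosed.completeSpace_coe _ _ _ _ ?_
    rw [this]
    exact isClosed_eq D.continuous (continuous_const_smul μ)
  obtain ⟨κ, b, hb⟩ := exists_hilbertBasis_of_orthogonalFamily hVc
   
    hsym.orthogonalFamily_eigenspaces (D.orthogonalComplement_iSup_eigenspaces_eq_bot hD hsym)
  choose μ hμ using hb
  refine ⟨κ, b, fun k => (μ k).re, fun k => ?_⟩
  have h0 : b k ≠ 0 := fun h => by simpa [h] using b.orthonormal.1 k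
  rw [Complex.conj_eq_iff_re.1 (hsym.conj_eigenvalue_eq_self
    (Module.End.hasEigenvalue_of_hasEigenvector ⟨hμ k, h0⟩))]
  exact Module.End.mem_eigenspace_iff.1 (hμ k)

/-! ### Lower bounds for the trace norm -/

theorem abs_re_inner_le_abs {T : 𝓗 →L[ℂ] 𝓗} (hT : IsSelfAdjoint T) (x : 𝓗) :
    |(⟪x, T x⟫_ℂ).re| ≤ (⟪x, CFC.abs T x⟫_ℂ).re := by
  have h1 : 0 ≤ CFC.abs T - T := by
    rw [CFC.abs_sub_self T]; exact smul_nonneg (by norm_num) (CFC.negPart_nonneg T)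
  have h2 : 0 ≤ CFC.abs T + T := by
    rw [CFC.abs_add_self T]; exact smul_nonneg (by norm_num) (CFC.posPart_nonneg T)
  have h1' := re_inner_nonneg ((ContinuousLinearMap.nonneg_iff_isPositive _).1 h1) x
  have h2' := re_inner_nonneg ((ContinuousLinearMap.nonneg_iff_isPositive _).1 h2) x
  simp only [sub_apply, add_apply, inner_sub_right,
    inner_add_right, Complex.sub_re, Complex.add_re] at h1' h2'
  exact abs_le.2 ⟨by linarith, by linarith⟩

theorem tsum_abs_le_traceNorm {T : 𝓗 →L[ℂ] 𝓗} (hT : IsSelfAdjoint T) (b : HilbertBasis ι ℂ 𝓗) :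
    ∑' i, ENNReal.ofReal |(⟪b i, T (b i)⟫_ℂ).re| ≤ traceNorm T := by
  rw [traceNorm, posTrace_eq_tsum
    ((ContinuousLinearMap.nonneg_iff_isPositive _).1 (CFC.abs_nonneg T)) b]
  exact ENNReal.tsum_le_tsum fun i => ENNReal.ofReal_le_ofReal (abs_re_inner_le_abs hT _)

/-! ### Cross terms of nearby states -/

theorem re_inner_mul_add_mul_comm (R S : 𝓗 →L[ℂ] 𝓗) (hR : IsSelfAdjoint R) (hS : IsSelfAdjoint S)
    (x : 𝓗) : (⟪x, (R * S + S * R) x⟫_ℂ).re = 2 * (⟪R x, S x⟫_ℂ).re := by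
  have h1 : ⟪x, R (S x)⟫_ℂ = ⟪R x, S x⟫_ℂ := (hR.isSymmetric x (S x)).symm
  have h2 : ⟪x, S (R x)⟫_ℂ = ⟪S x, R x⟫_ℂ := (hS.isSymmetric x (R x)).symm
  have h3 : (⟪S x, R x⟫_ℂ).re = (⟪R x, S x⟫_ℂ).re := inner_re_symm (𝕜 := ℂ) _ _
  simp only [add_apply, mul_apply_eq_comp, inner_add_right, Complex.add_re, h1, h2, h3]
  ring

theorem norm_sub_sq_eq (x y : 𝓗) :
    ‖x - y‖ ^ 2 = ‖x‖ ^ 2 - 2 * (⟪x, y⟫_ℂ).re + ‖y‖ ^ 2 :=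
  norm_sub_sq (𝕜 := ℂ) x y

/-- The Powers–Størmer inequality `‖R - S‖₂² ≤ ‖R² - S²‖₁` in an eigenbasis of `R - S`, for a
single eigenvector `x`: here `⟨x, (R² - S²) x⟩ = l ⟨x, (R + S) x⟩`, and
`⟨x, (R + S) x⟩ ≥ |⟨x, (R - S) x⟩| = |l|`. -/
theorem norm_apply_sq_le_abs_of_eigenvector {R S : 𝓗 →L[ℂ] 𝓗} (hR : R.IsPositive)
    (hS : S.IsPositive) {x : 𝓗} (hx : ‖x‖ = 1) {l : ℝ} (hl : (R - S) x = (l : ℂ) • x) :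
    ‖(R - S) x‖ ^ 2 ≤ |‖R x‖ ^ 2 - ‖S x‖ ^ 2| := by
  have hp := re_inner_nonneg hR x
  have hq := re_inner_nonneg hS x
  set p := (⟪x, R x⟫_ℂ).re with hpdef
  set q := (⟪x, S x⟫_ℂ).re with hqdef
  have hxx : (⟪x, x⟫_ℂ) = 1 := by rw [inner_self_eq_norm_sq_to_K, hx]; simp
  have hpq : p - q = l := by
    rw [hpdef, hqdef, ← Complex.sub_re, ← inner_sub_right, ← sub_apply, hl, inner_smul_right, hxx]
    simp
  have hSx : (⟪S x, x⟫_ℂ).re = q := inner_re_symm (𝕜 := ℂ) _ _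
  have hRx : R x = S x + (l : ℂ) • x := by rw [← hl, sub_apply]; abel
  have hn : ‖R x‖ ^ 2 = ‖S x‖ ^ 2 + 2 * (l * q) + l ^ 2 := by
    rw [hRx, norm_add_sq (𝕜 := ℂ), inner_smul_right, norm_smul, hx]
    simp [hSx]
  have h1 : ‖R x‖ ^ 2 - ‖S x‖ ^ 2 = l * (p + q) := by
    rw [hn, show p = q + l by linarith]; ring
  rw [h1, hl, norm_smul, hx, abs_mul, abs_of_nonneg (add_nonneg hp hq)]
  have h2 : |l| ≤ p + q := by rw [← hpq, abs_le]; constructor <;> linarith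
  calc (‖(l : ℂ)‖ * 1) ^ 2 = |l| * |l| := by simp [sq]
    _ ≤ _ := by gcongr

/-- The cross term `ρ^(1/2) σ^(1/2) + σ^(1/2) ρ^(1/2)`, of overlap `c = Tr ρ^(1/2) σ^(1/2)`. The
bound on `1 - c` is the Powers–Størmer inequality. -/
theorem exists_isCrossTerm {ρ σ : 𝓗 →L[ℂ] 𝓗} (hρ : IsState ρ) (hσ : IsState σ) :
    ∃ (C : 𝓗 →L[ℂ] 𝓗) (c : ℝ), IsCrossTerm ρ σ C c ∧
      ENNReal.ofReal (2 * (1 - c)) ≤ traceNorm (ρ - σ) := by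
  set R := CFC.sqrt ρ with hRdef
  set S := CFC.sqrt σ with hSdef
  have hR : R.IsPositive := (ContinuousLinearMap.nonneg_iff_isPositive _).1 (CFC.sqrt_nonneg ρ)
  have hS : S.IsPositive := (ContinuousLinearMap.nonneg_iff_isPositive _).1 (CFC.sqrt_nonneg σ)
  have hC (x : 𝓗) : (⟪x, (R * S + S * R) x⟫_ℂ).re = 2 * (⟪R x, S x⟫_ℂ).re :=
    re_inner_mul_add_mul_comm R S hR.isSelfAdjoint hS.isSelfAdjoint x
  have hρR (x : 𝓗) : (⟪x, ρ x⟫_ℂ).re = ‖R x‖ ^ 2 := re_inner_eq_norm_sqrt_sq hρ.1 x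
  have hσS (x : 𝓗) : (⟪x, σ x⟫_ℂ).re = ‖S x‖ ^ 2 := re_inner_eq_norm_sqrt_sq hσ.1 x
  have hCS (x : 𝓗) : |(⟪R x, S x⟫_ℂ).re| ≤ ‖R x‖ * ‖S x‖ :=
    (Complex.abs_re_le_norm _).trans (norm_inner_le_norm _ _)
  have hsρ : HasSum (fun i => ‖R (onb 𝓗 i)‖ ^ 2) 1 := by
    simpa only [hρR] using hρ.hasSum (onb 𝓗)
  have hsσ : HasSum (fun i => ‖S (onb 𝓗 i)‖ ^ 2) 1 := by
    simpa only [hσS] using hσ.hasSum (onb 𝓗)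
  have hsum : Summable fun i => (⟪R (onb 𝓗 i), S (onb 𝓗 i)⟫_ℂ).re := by
    refine Summable.of_norm_bounded (hsρ.summable.add hsσ.summable) fun i => ?_
    have := hCS (onb 𝓗 i)
    rw [Real.norm_eq_abs]
    nlinarith [sq_nonneg (‖R (onb 𝓗 i)‖ - ‖S (onb 𝓗 i)‖), sq_nonneg ‖R (onb 𝓗 i)‖,
      sq_nonneg ‖S (onb 𝓗 i)‖]
  obtain ⟨c, hc⟩ := hsum
  refine ⟨R * S + S * R, c, ⟨?_, fun x => ?_, ?_⟩, ?_⟩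
  · rw [isSelfAdjoint_iff, star_add, star_mul, star_mul, hR.isSelfAdjoint.star_eq,
      hS.isSelfAdjoint.star_eq, add_comm]
  · rw [hC, hρR, hσS]
    have := sq_le_sq' (abs_le.1 (hCS x)).1 (abs_le.1 (hCS x)).2
    nlinarith
  · simpa only [hC] using hc.mul_left 2
  · have hD : HasSum (fun i => ‖(R - S) (onb 𝓗 i)‖ ^ 2) (2 * (1 - c)) := by
      have h := (hsρ.sub (hc.mul_left 2)).add hsσ
      rw [show 1 - 2 * c + 1 = 2 * (1 - c) by ring] at h
      simpa only [sub_apply, norm_sub_sq_eq] using h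
    have hDe : ∑' i, ‖(R - S) (onb 𝓗 i)‖ₑ ^ 2 = ENNReal.ofReal (2 * (1 - c)) := by
      rw [← hD.tsum_eq, ENNReal.ofReal_tsum_of_nonneg (fun i => by positivity) hD.summable]
      exact tsum_congr fun i => enorm_sq_eq_ofReal _
    have hDsa : IsSelfAdjoint (R - S) := hR.isSelfAdjoint.sub hS.isSelfAdjoint
    obtain ⟨κ, b, l, hl⟩ := exists_eigenbasis
      (isCompactOperator_of_tsum_ne_top (onb 𝓗) (hDe ▸ ENNReal.ofReal_ne_top)) hDsa
    rw [← hDe, tsum_enorm_sq_star (onb 𝓗) b, hDsa.star_eq]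
    refine le_trans (ENNReal.tsum_le_tsum fun k => ?_)
      (tsum_abs_le_traceNorm (hρ.1.isSelfAdjoint.sub hσ.1.isSelfAdjoint) b)
    rw [enorm_sq_eq_ofReal, sub_apply ρ σ, inner_sub_right, Complex.sub_re, hρR, hσS]
    exact ENNReal.ofReal_le_ofReal
      (norm_apply_sq_le_abs_of_eigenvector hR hS (b.orthonormal.1 k) (hl k))

theorem re_inner_rankOne_self (φ x : 𝓗) :
    (⟪x, InnerProductSpace.rankOne ℂ φ φ x⟫_ℂ).re = ‖⟪x, φ⟫_ℂ‖ ^ 2 := by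
  rw [InnerProductSpace.rankOne_apply, inner_smul_right, ← inner_conj_symm φ x, RCLike.conj_mul]
  simp [← Complex.ofReal_pow]

/-- A difference of states has trace `0`, so half of its trace norm bounds each of its expectation
values. -/
theorem two_mul_re_inner_le_traceNorm {ρ σ : 𝓗 →L[ℂ] 𝓗} (hρ : IsState ρ) (hσ : IsState σ)
    {g : 𝓗} (hg : ‖g‖ = 1) :
    ENNReal.ofReal (2 * (⟪g, (ρ - σ) g⟫_ℂ).re) ≤ traceNorm (ρ - σ) := by
  have hort : Orthonormal ℂ ((↑) : ({g} : Set 𝓗) → 𝓗) :=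
    ⟨fun v => by rw [v.2, hg], fun v w hvw => absurd (Subsingleton.elim v w) hvw⟩
  obtain ⟨w, b, hgw, hb⟩ := hort.exists_hilbertBasis_extension
  let k : w := ⟨g, hgw rfl⟩
  have hk : b k = g := by rw [hb]
  have h0 : HasSum (fun i => (⟪b i, (ρ - σ) (b i)⟫_ℂ).re) 0 := by
    have := (hρ.hasSum b).sub (hσ.hasSum b)
    simpa only [sub_apply, inner_sub_right, Complex.sub_re, sub_self] using this
  refine le_trans ?_ (tsum_abs_le_traceNorm (hρ.1.isSelfAdjoint.sub hσ.1.isSelfAdjoint) b)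
  rw [← ENNReal.ofReal_tsum_of_nonneg (fun i => abs_nonneg _) h0.summable.abs]
  refine ENNReal.ofReal_le_ofReal ?_
  have h1 := h0.summable.abs.hasSum.add h0
  rw [add_zero] at h1
  refine le_trans ?_ (le_hasSum h1 k fun j _ => by linarith [neg_abs_le (⟪b j, (ρ - σ) (b j)⟫_ℂ).re])
  rw [hk]
  linarith [le_abs_self (⟪g, (ρ - σ) g⟫_ℂ).re]

/-- Pure states with overlap `c = ⟨ψ, φ⟩ ≥ 0` have trace distance at least `√(1 - c²)`. -/
theorem le_traceNorm_rankOne_sub {φ ψ : 𝓗} (hφ : ‖φ‖ = 1) (hψ : ‖ψ‖ = 1) {c : ℝ} (hc : 0 ≤ c)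
    (h : ⟪ψ, φ⟫_ℂ = c) (hρ : IsState (InnerProductSpace.rankOne ℂ φ φ))
    (hσ : IsState (InnerProductSpace.rankOne ℂ ψ ψ)) :
    ENNReal.ofReal (2 * √(1 - c ^ 2)) ≤
      traceNorm (InnerProductSpace.rankOne ℂ φ φ - InnerProductSpace.rankOne ℂ ψ ψ) := by
  rcases (Real.sqrt_nonneg (1 - c ^ 2)).eq_or_lt with h0 | h0
  · rw [← h0]; simp
  have hc2 : 0 < 1 - c ^ 2 := Real.sqrt_pos.1 h0
  set s := √(1 - c ^ 2) with hsdef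
  have hs2 : s ^ 2 = 1 - c ^ 2 := Real.sq_sqrt hc2.le
  have hs1 : s ≤ 1 := by nlinarith
  -- `g = (p φ - q ψ) / s` is the unit eigenvector of the difference for the eigenvalue `s`
  set p := √((1 + s) / 2) with hp
  set q := √((1 - s) / 2) with hq
  have hp2 : p ^ 2 = (1 + s) / 2 := Real.sq_sqrt (by linarith)
  have hq2 : q ^ 2 = (1 - s) / 2 := Real.sq_sqrt (by linarith)
  have hpq : c = 2 * (p * q) := by
    have hp0 : 0 ≤ p := Real.sqrt_nonneg _
    have hq0 : 0 ≤ q := Real.sqrt_nonneg _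
    refine (pow_left_inj₀ hc (by positivity) two_ne_zero).1 ?_
    rw [mul_pow, mul_pow, hp2, hq2]; nlinarith
  have hφφ : ⟪φ, φ⟫_ℂ = 1 := by rw [inner_self_eq_norm_sq_to_K, hφ]; simp
  have hψψ : ⟪ψ, ψ⟫_ℂ = 1 := by rw [inner_self_eq_norm_sq_to_K, hψ]; simp
  have h' : ⟪φ, ψ⟫_ℂ = c := by rw [← inner_conj_symm, h, Complex.conj_ofReal]
  let g : 𝓗 := ((p / s : ℝ) : ℂ) • φ - ((q / s : ℝ) : ℂ) • ψ
  have hgφ : ⟪g, φ⟫_ℂ = (p : ℂ) := by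
    have : p / s - q / s * c = p := by
      rw [hpq]; field_simp; linear_combination (-2 * p) * hq2
    simp only [g, inner_sub_left, inner_smul_left, hφφ, h, Complex.conj_ofReal]
    rw [mul_one]
    exact_mod_cast this
  have hgψ : ⟪g, ψ⟫_ℂ = (q : ℂ) := by
    have : p / s * c - q / s = q := by
      rw [hpq]; field_simp; linear_combination (2 * q) * hp2
    simp only [g, inner_sub_left, inner_smul_left, hψψ, h', Complex.conj_ofReal]
    rw [mul_one]
    exact_mod_cast this
  have hg : ‖g‖ = 1 := by
    have h1 : ⟪g, g⟫_ℂ = 1 := by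
      have : p / s * p - q / s * q = 1 := by field_simp; linear_combination hp2 - hq2
      nth_rw 2 [show g = ((p / s : ℝ) : ℂ) • φ - ((q / s : ℝ) : ℂ) • ψ from rfl]
      rw [inner_sub_right, inner_smul_right, inner_smul_right, hgφ, hgψ]
      exact_mod_cast this
    have h2 := inner_self_eq_norm_sq (𝕜 := ℂ) g
    rw [h1] at h2
    have h3 : ‖g‖ ^ 2 = 1 := by simpa using h2.symm
    exact (pow_eq_one_iff_of_nonneg (norm_nonneg g) two_ne_zero).1 h3
  convert two_mul_re_inner_le_traceNorm hρ hσ hg using 3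
  rw [sub_apply, inner_sub_right, Complex.sub_re, re_inner_rankOne_self, re_inner_rankOne_self,
    hgφ, hgψ, Complex.norm_real, Complex.norm_real, Real.norm_eq_abs, Real.norm_eq_abs, sq_abs,
    sq_abs, hp2, hq2]
  ring

/-- For pure states the cross term `|φ⟩⟨ψ| + |ψ⟩⟨φ|` can be used, with the phase of `φ` chosen so
that `⟨ψ, φ⟩ ≥ 0`. -/
theorem exists_isCrossTerm_of_isPure {ρ σ : 𝓗 →L[ℂ] 𝓗} (hρ : IsState ρ) (hσ : IsState σ)
    (hρp : IsPure ρ) (hσp : IsPure σ) :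
    ∃ (C : 𝓗 →L[ℂ] 𝓗) (c : ℝ), IsCrossTerm ρ σ C c ∧ 0 ≤ c ∧
      ENNReal.ofReal (2 * √(1 - c ^ 2)) ≤ traceNorm (ρ - σ) := by
  obtain ⟨φ₀, hφ₀, hρφ₀⟩ := hρp
  obtain ⟨ψ, hψ, rfl⟩ := hσp
  obtain ⟨μ, hμ, hμi⟩ := RCLike.exists_norm_eq_mul_self ⟪ψ, φ₀⟫_ℂ
  have hφ : ‖μ • φ₀‖ = 1 := by rw [norm_smul, hμ, hφ₀, one_mul]
  have hρφ : ρ = InnerProductSpace.rankOne ℂ (μ • φ₀) (μ • φ₀) := by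
    have : starRingEnd ℂ μ * μ = 1 := by rw [RCLike.conj_mul, hμ]; simp
    ext x
    rw [hρφ₀, InnerProductSpace.rankOne_apply, InnerProductSpace.rankOne_apply, inner_smul_left,
      smul_smul, mul_right_comm, this, one_mul]
  have hin : ⟪ψ, μ • φ₀⟫_ℂ = (‖⟪ψ, φ₀⟫_ℂ‖ : ℂ) := by
    rw [inner_smul_right]; exact hμi.symm
  have hc : 0 ≤ ‖⟪ψ, φ₀⟫_ℂ‖ := norm_nonneg _
  generalize μ • φ₀ = φ at hφ hρφ hin
  generalize ‖⟪ψ, φ₀⟫_ℂ‖ = c at hin hc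
  subst hρφ
  have hsym (x : 𝓗) : (⟪x, (InnerProductSpace.rankOne ℂ φ ψ +
      InnerProductSpace.rankOne ℂ ψ φ) x⟫_ℂ).re = 2 * (⟪x, φ⟫_ℂ * ⟪ψ, x⟫_ℂ).re := by
    have h1 : (⟪x, ψ⟫_ℂ * ⟪φ, x⟫_ℂ).re = (⟪x, φ⟫_ℂ * ⟪ψ, x⟫_ℂ).re := by
      rw [← inner_conj_symm x ψ, ← inner_conj_symm φ x, ← map_mul, Complex.conj_re, mul_comm]
    rw [add_apply, inner_add_right, Complex.add_re, InnerProductSpace.rankOne_apply,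
      InnerProductSpace.rankOne_apply, inner_smul_right, inner_smul_right, mul_comm ⟪ψ, x⟫_ℂ,
      mul_comm ⟪φ, x⟫_ℂ, h1]
    ring
  refine ⟨InnerProductSpace.rankOne ℂ φ ψ + InnerProductSpace.rankOne ℂ ψ φ, c,
    ⟨?_, fun x => ?_, ?_⟩, hc, le_traceNorm_rankOne_sub hφ hψ hc hin hρ hσ⟩
  · rw [isSelfAdjoint_iff, star_add, ContinuousLinearMap.star_eq_adjoint,
      ContinuousLinearMap.star_eq_adjoint, InnerProductSpace.adjoint_rankOne,
      InnerProductSpace.adjoint_rankOne, add_comm]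
  · rw [hsym, re_inner_rankOne_self, re_inner_rankOne_self]
    have h1 : |(⟪x, φ⟫_ℂ * ⟪ψ, x⟫_ℂ).re| ≤ ‖⟪x, φ⟫_ℂ‖ * ‖⟪x, ψ⟫_ℂ‖ := by
      rw [norm_inner_symm x ψ, ← norm_mul]
      exact Complex.abs_re_le_norm _
    have h2 := sq_le_sq' (abs_le.1 h1).1 (abs_le.1 h1).2
    rw [mul_pow] at h2
    linarith
  · have h := ((onb 𝓗).hasSum_inner_mul_inner ψ φ).mapL Complex.reCLM
    rw [hin, Complex.reCLM_apply, Complex.ofReal_re] at h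
    refine (h.mul_left 2).congr_fun fun i => ?_
    rw [hsym, Complex.reCLM_apply, mul_comm ⟪ψ, _⟫_ℂ]

/-! ### Uniform continuity -/

theorem tendsto_contBound {D a b : ℝ → ℝ} {E : ℝ} (hE : 0 < E)
    (hD : D =o[atTop] fun E : ℝ => √E) (ha : Tendsto a (𝓝[>] 0) (𝓝 0))
    (hb : Tendsto b (𝓝[>] 0) (𝓝 0)) :
    Tendsto (contBound D a b E) (𝓝[>] 0) (𝓝 0) := by
  have hδ : Tendsto (fun ε : ℝ => √(2 * ε)) (𝓝[>] 0) (𝓝 0) := by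
    have : Continuous fun ε : ℝ => √(2 * ε) := by fun_prop
    simpa using (this.tendsto 0).mono_left nhdsWithin_le_nhds
  have hr : Tendsto (fun ε : ℝ => √(2 * ε) / (1 + √(2 * ε))) (𝓝[>] 0) (𝓝[>] 0) := by
    refine tendsto_nhdsWithin_iff.2 ⟨?_, ?_⟩
    · have h := hδ.div (tendsto_const_nhds.add hδ) (by norm_num : (1 : ℝ) + 0 ≠ 0)
      rw [zero_div] at h
      exact h
    · filter_upwards [self_mem_nhdsWithin] with ε hε
      have : (0 : ℝ) < ε := hε
      exact Set.mem_Ioi.2 (by positivity)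
  have hEε : Tendsto (fun ε : ℝ => E / ε) (𝓝[>] 0) atTop := by
    simpa only [div_eq_mul_inv] using tendsto_inv_nhdsGT_zero.const_mul_atTop hE
  have h1 : Tendsto (fun ε : ℝ => √(2 * ε) * D (E / ε)) (𝓝[>] 0) (𝓝 0) := by
    have h := (hD.tendsto_div_nhds_zero.comp hEε).const_mul (√(2 * E))
    rw [mul_zero] at h
    refine h.congr' ?_
    filter_upwards [self_mem_nhdsWithin] with ε hε
    have hε : (0 : ℝ) < ε := hε
    have h2 : √(2 * E) = √(2 * ε) * √(E / ε) := by
      rw [← Real.sqrt_mul (by positivity)]; congr 1; field_simp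
    have h3 : √(E / ε) ≠ 0 := by positivity
    simp only [Function.comp]
    rw [h2]
    field_simp
  have h2 := h1.add ((tendsto_const_nhds (x := (1 : ℝ)).add hδ).mul
    ((ha.comp hr).add (hb.comp hr)))
  simp only [add_zero, mul_zero] at h2
  exact h2

theorem le_of_ofReal_two_mul_le {x ε : ℝ} (hε : 0 ≤ ε) {N : ENNReal}
    (h : ENNReal.ofReal (2 * x) ≤ N) (hN : N / 2 ≤ ENNReal.ofReal ε) : x ≤ ε := by
  have h1 : N ≤ ENNReal.ofReal (2 * ε) := by
    rw [ENNReal.div_le_iff two_ne_zero ENNReal.ofNat_ne_top] at hN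
    refine hN.trans_eq ?_
    rw [mul_comm 2 ε, ENNReal.ofReal_mul hε, ENNReal.ofReal_ofNat]
  have := (ENNReal.ofReal_le_ofReal_iff (by positivity)).1 (h.trans h1)
  linarith

end QState

theorem theorem1 {𝓗 : Type*} [NormedAddCommGroup 𝓗] [InnerProductSpace ℂ 𝓗] [CompleteSpace 𝓗]
    (H : 𝓗 →ₗ.[ℂ] 𝓗) (hH : QState.IsHamiltonian H)
    (f : (𝓗 →L[ℂ] 𝓗) → ℝ) (a b : ℝ → ℝ) (hf : QState.IsLAA H f a b)
    (hB : ∀ E : ℝ, QState.groundEnergy H ≤ E →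
      BddAbove ((fun ρ => |f ρ|) '' QState.energySet H E)) :
    -- the continuity bound, with `2 B_f` and with `B_f⁺ + B_f⁻`
    (∀ E : ℝ, QState.groundEnergy H ≤ E →
      ∀ ρ ∈ QState.energySet H E, ∀ σ ∈ QState.energySet H E,
      ∀ ε : ℝ, 0 < ε → ε ≤ 1 / 2 → QState.traceNorm (ρ - σ) / 2 ≤ ENNReal.ofReal ε →
        |f ρ - f σ| ≤ QState.contBound (fun t => 2 * QState.supAbs H f t) a b E ε ∧
        |f ρ - f σ| ≤
          QState.contBound (fun t => QState.supPos H f t + QState.supNeg H f t) a b E ε) ∧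
    -- pure states: `ε` is replaced by `ε ^ 2 / 2`
    (∀ E : ℝ, QState.groundEnergy H ≤ E →
      ∀ ρ ∈ QState.energySet H E, ∀ σ ∈ QState.energySet H E,
      QState.IsPure ρ → QState.IsPure σ →
      ∀ ε : ℝ, 0 < ε → ε ≤ 1 → QState.traceNorm (ρ - σ) / 2 ≤ ENNReal.ofReal ε →
        |f ρ - f σ| ≤ QState.contBound (fun t => 2 * QState.supAbs H f t) a b E (ε ^ 2 / 2) ∧
        |f ρ - f σ| ≤
          QState.contBound (fun t => QState.supPos H f t + QState.supNeg H f t) a b E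
            (ε ^ 2 / 2)) ∧
    -- uniform continuity on the energy-bounded sets
    ((QState.supAbs H f =o[atTop] fun E : ℝ => √E) →
      ∀ E : ℝ, QState.groundEnergy H ≤ E →
        QState.TraceNormUniformContinuousOn f (QState.energySet H E)) := by
  have part1 (E : ℝ) (hE : QState.groundEnergy H ≤ E) (ρ : 𝓗 →L[ℂ] 𝓗)
      (hρ : ρ ∈ QState.energySet H E) (σ : 𝓗 →L[ℂ] 𝓗) (hσ : σ ∈ QState.energySet H E) (ε : ℝ)
      (hε : 0 < ε) (hε1 : ε ≤ 1 / 2) (hd : QState.traceNorm (ρ - σ) / 2 ≤ ENNReal.ofReal ε) :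
      |f ρ - f σ| ≤ QState.contBound (fun t => 2 * QState.supAbs H f t) a b E ε ∧
        |f ρ - f σ| ≤
          QState.contBound (fun t => QState.supPos H f t + QState.supNeg H f t) a b E ε := by
    obtain ⟨C, c, hC, hc⟩ := QState.exists_isCrossTerm hρ.1 hσ.1
    have h := QState.le_of_ofReal_two_mul_le hε.le hc hd
    exact hC.abs_sub_le hH hf hB hE hρ hσ (by linarith) hε hε1 (by nlinarith)
  refine ⟨part1, fun E hE ρ hρ σ hσ hρp hσp ε hε hε1 hd => ?_, fun ho E hE η hη => ?_⟩
  · obtain ⟨C, c, hC, hc0, hc⟩ := QState.exists_isCrossTerm_of_isPure hρ.1 hσ.1 hρp hσp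
    have h := (Real.sqrt_le_left hε.le).1 (QState.le_of_ofReal_two_mul_le hε.le hc hd)
    exact hC.abs_sub_le hH hf hB hE hρ hσ hc0 (by positivity) (by nlinarith) (by linarith)
  · have ho' : (fun t => 2 * QState.supAbs H f t) =o[atTop] fun E : ℝ => √E :=
      ho.const_mul_left 2
    -- enlarging `E` makes it positive, so that `E / ε → ∞`
    have hE1 : 0 < max E 1 := lt_max_of_lt_right one_pos
    have hev := (QState.tendsto_contBound hE1 ho' hf.a_tendsto hf.b_tendsto).eventually_lt_const hη
    obtain ⟨ε, ⟨hεη, hε1⟩, hε⟩ := ((hev.and (eventually_nhdsWithin_of_eventually_nhds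
      (eventually_le_nhds (by norm_num : (0 : ℝ) < 1 / 2)))).and self_mem_nhdsWithin).exists
    have hε : 0 < ε := hε
    refine ⟨2 * ε, by positivity, fun ρ hρ σ hσ hd => ?_⟩
    refine (part1 _ (hE.trans (le_max_left E 1)) ρ (QState.energySet_mono H (le_max_left E 1) hρ) σ
      (QState.energySet_mono H (le_max_left E 1) hσ) ε hε hε1 ?_).1.trans_lt hεη
    refine ENNReal.div_le_of_le_mul (hd.le.trans_eq ?_)
    rw [mul_comm, ENNReal.ofReal_mul hε.le, ENNReal.ofReal_ofNat]
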